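/- \textbf{Setting.} Let $\varphi(\cdot-\theta)$ denote the $\mathcal N(\theta,1)$ density, and for a probability distribution $G$ on $\mathbb R$ let $f_G(x)=\int\varphi(x-\theta)\,dG(\theta)$. For a decision rule $\delta:\mathbb R\to\mathbb R$ put $R(\delta,\theta)=\int(\delta(x)-\theta)^2\varphi(x-\theta)\,dx$ and $r(G,\delta)=\int R(\delta,\theta)\,dG(\theta)$. Fix $\epsilon\in(0,1)$. For an initial prior $G$, a Mallows least favorable prior is a distribution $G^*$ that minimizes the Fisher information $I(\Phi*G')=\int f_{G'}'(x)^2/f_{G'}(x)\,dx$ over all $G'=(1-\epsilon)G+\epsilon H$, with $H$ an arbitrary probability distribution on $\mathbb R$. The Mallows (Hodges--Lehmann restricted Bayes) rule for $G$ is the posterior mean under $G^*$, $\delta(x)=\int\theta\varphi(x-\theta)\,dG^*(\theta)/\int\varphi(x-\theta)\,dG^*(\theta)$. Let $G_0$ be a probability distribution on $\mathbb R$ and let $X_1,X_2,\dots$ be random variables on one probability space, each with marginal density $f_{G_0}$. For each $n$ let $\hat G=\hat G_n$ be a nonparametric maximum likelihood estimate, i.e. a maximizer of $\sum_{i=1}^n\log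 f_G(X_i)$ over all probability distributions $G$ on $\mathbb R$. Let $\delta^M$ be a Mallows rule for $G_0$ and $\hat\delta^M=\hat\delta^M_n$ a Mallows rule for $\hat G_n$, both with the same $\epsilon$. Let $h(f,g)=\big(\tfrac12\int(\sqrt f-\sqrt g)^2\,dx\big)^{1/2}$ be the Hellinger distance. \textbf{Theorem.} The Bayes risks $r(G_0,\delta^M)$ and $r(G_0,\hat\delta^M_n)$ are finite (the latter computed for the given sample, hence random), and if the NPMLE marginal density is Hellinger consistent, then the excess Bayes risk vanishes as $n\to\infty$: \[ r(G_0,\hat\delta^M_n)-r(G_0,\delta^M)\to 0 . \] Precisely: if $h(f_{\hat G_n},f_{G_0})\to0$ almost surely, then the convergence holds almost surely; if $h(f_{\hat G_n},f_{G_0})\to0$ in probability, then the convergence holds in probability and in mean, i.e. also $\mathbb E\,|r(G_0,\hat\delta^M_n)-r(G_0,\delta^M)|\to0$. -/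

import Mathlib

open MeasureTheory ProbabilityTheory Filter Topology
open scoped ENNReal

noncomputable section

/-- The marginal density `f_G(x) = ∫ φ(x - θ) dG(θ)` of the standard Gaussian location model
with mixing distribution `G`. -/
def mixtureDensity (G : Measure ℝ) (x : ℝ) : ℝ :=
  ∫ θ, gaussianPDFReal θ 1 x ∂G

/-- The law `Φ * G` of an observation: the measure on `ℝ` with density `f_G`. -/
def mixtureLaw (G : Measure ℝ) : Measure ℝ :=
  volume.withDensity fun x => ENNReal.ofReal (mixtureDensity G x)

/-- Fisher information for location `∫ f'(x)² / f(x) dx` of a (positive, differentiable)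
density `f`. -/
def fisherInfo (f : ℝ → ℝ) : ℝ≥0∞ :=
  ∫⁻ x, ENNReal.ofReal (deriv f x ^ 2 / f x)

/-- The posterior mean of `θ` given `X = x` under the prior `G`. -/
def posteriorMean (G : Measure ℝ) (x : ℝ) : ℝ :=
  (∫ θ, θ * gaussianPDFReal θ 1 x ∂G) / ∫ θ, gaussianPDFReal θ 1 x ∂G

/-- Pointwise quadratic risk `R(δ, θ) = E_θ (δ(X) - θ)²`, where `X ∼ N(θ, 1)`. -/
def pointwiseRisk (δ : ℝ → ℝ) (θ : ℝ) : ℝ≥0∞ :=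
  ∫⁻ x, ENNReal.ofReal ((δ x - θ) ^ 2) ∂(gaussianReal θ 1)

/-- Bayes risk `r(G, δ) = ∫ R(δ, θ) dG(θ)`. -/
def quadBayesRisk (G : Measure ℝ) (δ : ℝ → ℝ) : ℝ≥0∞ :=
  ∫⁻ θ, pointwiseRisk δ θ ∂G

/-- The contamination class of all priors `(1 - ε) G + ε H`, with `H` an arbitrary probability
distribution on `ℝ`. -/
def contaminationClass (ε : ℝ) (G : ProbabilityMeasure ℝ) : Set (Measure ℝ) :=
  {G' | ∃ H : ProbabilityMeasure ℝ,
    G' = ENNReal.ofReal (1 - ε) • (G : Measure ℝ) + ENNReal.ofReal ε • (H : Measure ℝ)}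

/-- `G'` is a Mallows least favorable prior for the initial prior `G` and the contamination
level `ε`: it minimizes `I(Φ * ·)` over the contamination class. -/
def IsMallowsPrior (ε : ℝ) (G : ProbabilityMeasure ℝ) (G' : Measure ℝ) : Prop :=
  G' ∈ contaminationClass ε G ∧
    ∀ G'' ∈ contaminationClass ε G,
      fisherInfo (mixtureDensity G') ≤ fisherInfo (mixtureDensity G'')

/-- `δ` is the Mallows (Hodges-Lehmann restricted Bayes) rule for the initial prior `G` and the
contamination level `ε`: the posterior mean under the Mallows least favorable prior. -/
def IsMallowsRule (ε : ℝ) (G : ProbabilityMeasure ℝ) (δ : ℝ → ℝ) : Prop :=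
  ∃ G' : Measure ℝ, IsMallowsPrior ε G G' ∧ δ = posteriorMean G'

/-- `G` is a nonparametric maximum likelihood estimate of the mixing distribution based on the
observations `x 0, …, x (n - 1)`. -/
def IsNPMLE (n : ℕ) (x : ℕ → ℝ) (G : ProbabilityMeasure ℝ) : Prop :=
  ∀ G' : ProbabilityMeasure ℝ,
    ∑ i ∈ Finset.range n, Real.log (mixtureDensity G' (x i)) ≤
      ∑ i ∈ Finset.range n, Real.log (mixtureDensity G (x i))

/-- Hellinger distance `(½ ∫ (√f - √g)²)^{1/2}` between two densities. -/
def hellingerDist (f g : ℝ → ℝ) : ℝ :=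
  √((1 / 2) * ∫ x, (√(f x) - √(g x)) ^ 2)

/-- The excess Bayes risk `r(G, δ') - r(G, δ)`. -/
def excessRisk (G : Measure ℝ) (δ' δ : ℝ → ℝ) : ℝ :=
  (quadBayesRisk G δ').toReal - (quadBayesRisk G δ).toReal

end

/-! ### Gaussian kernel -/

/-! Write B(G) for the Bayes risk of the posterior mean under G. Brown's identity B(G) + I(Φ*G) = 1
says that a Mallows prior maximizes B over a convex class. Since r(·, δ) is linear in the prior,
perturbing the maximizer gives a saddle point: r(K, δ_{G'}) ≤ B(G') for every K in the class
(`IsMallowsPrior.quadBayesRisk_le`). Contaminating by point masses then bounds the risk function of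
every Mallows rule by 1/ε, whatever the initial prior.

Hellinger convergence of the mixtures forces G_n → G₀ weakly, through characteristic functions. Let
G_n' = (1-ε)G_n + εH_n and G₀' = (1-ε)G₀ + εH₀ be the Mallows priors, with rules δ_n and δ₀. Nothing
is known about H_n, and nothing is needed. The prior (1-ε)G_n + εH₀ competes with G_n', so liminf
B(G_n') ≥ B(G₀') by lower semicontinuity. The prior (1-ε)G₀ + εH_n competes with G₀', so by the
saddle point r(G_n', δ₀) exceeds B(G₀') by at most (1-ε)(r(G_n, δ₀) - r(G₀, δ₀)), which tends to 0.
As r(G_n', δ₀) - B(G_n') = ∫(δ_n - δ₀)² f_{G_n'}, the rules merge in L²(f_{G_n})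
(`tendsto_lintegral_sq_sub_mallows`).

A uniform local lower bound on f_{G_n} and a tail bound carry this to L²(N(θ,1)) for each θ. Hence
risks converge pointwise in θ, and the bound 1/ε allows integration against G₀. The probabilistic
statements follow because the excess risk is controlled by a deterministic modulus in the Hellinger
distance. -/

lemma gaussianPDFReal_one (θ x : ℝ) :
    gaussianPDFReal θ 1 x = (√(2 * Real.pi))⁻¹ * Real.exp (-(x - θ) ^ 2 / 2) := by
  simp [gaussianPDFReal]

lemma inv_sqrt_two_pi_le_one : (√(2 * Real.pi))⁻¹ ≤ 1 := by
  apply inv_le_one_of_one_le₀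
  rw [Real.one_le_sqrt]
  linarith [Real.pi_gt_three]

/-- The centred moments `∫ (θ - x)ᵏ φ(x - θ) dG(θ)` of the kernel. -/
noncomputable def kernelMoment (k : ℕ) (G : Measure ℝ) (x : ℝ) : ℝ :=
  ∫ θ, (θ - x) ^ k * gaussianPDFReal θ 1 x ∂G

lemma continuous_kernelMoment_integrand (k : ℕ) (x : ℝ) :
    Continuous fun θ : ℝ => (θ - x) ^ k * gaussianPDFReal θ 1 x := by
  simp only [gaussianPDFReal_one]
  fun_prop

/-- Centring at x lets the Gaussian absorb the power, by 1 + u ≤ exp u with u = (θ - x)²/2. So no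
moments of the prior are needed, and these moments pass to weak limits. -/
lemma abs_kernelMoment_integrand_le {k : ℕ} (hk : k ≤ 2) (x θ : ℝ) :
    |(θ - x) ^ k * gaussianPDFReal θ 1 x| ≤ 2 := by
  rw [gaussianPDFReal_one]
  have h1 := inv_sqrt_two_pi_le_one
  have h0 : 0 ≤ (√(2 * Real.pi))⁻¹ := by positivity
  have he : (1 + (θ - x) ^ 2 / 2) * Real.exp (-(x - θ) ^ 2 / 2) ≤ 1 := by
    have h2 := Real.add_one_le_exp ((θ - x) ^ 2 / 2)
    have h3 : Real.exp ((θ - x) ^ 2 / 2) * Real.exp (-(x - θ) ^ 2 / 2) = 1 := by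
      rw [← Real.exp_add, ← Real.exp_zero]; ring_nf
    nlinarith [Real.exp_pos (-(x - θ) ^ 2 / 2)]
  have hp : |(θ - x) ^ k| ≤ 2 * (1 + (θ - x) ^ 2 / 2) := by
    rw [abs_pow]
    have := sq_abs (θ - x)
    have := abs_nonneg (θ - x)
    interval_cases k
    · nlinarith
    · nlinarith [sq_nonneg (|θ - x| - 1)]
    · nlinarith
  rw [abs_mul, abs_of_nonneg (by positivity : (0 : ℝ) ≤ (√(2 * Real.pi))⁻¹ * _)]
  have hepos := Real.exp_pos (-(x - θ) ^ 2 / 2)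
  calc |(θ - x) ^ k| * ((√(2 * Real.pi))⁻¹ * Real.exp (-(x - θ) ^ 2 / 2))
      ≤ 2 * (1 + (θ - x) ^ 2 / 2) * (1 * Real.exp (-(x - θ) ^ 2 / 2)) := by gcongr
    _ ≤ 2 := by linarith

lemma integrable_kernelMoment_integrand {k : ℕ} (hk : k ≤ 2) (G : Measure ℝ) [IsFiniteMeasure G]
    (x : ℝ) : Integrable (fun θ : ℝ => (θ - x) ^ k * gaussianPDFReal θ 1 x) G :=
  .of_bound (continuous_kernelMoment_integrand k x).aestronglyMeasurable 2
    (.of_forall fun θ => abs_kernelMoment_integrand_le hk x θ)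

lemma kernelMoment_zero (G : Measure ℝ) (x : ℝ) : kernelMoment 0 G x = mixtureDensity G x := by
  simp [kernelMoment, mixtureDensity]

lemma integrable_gaussianPDFReal_mean (G : Measure ℝ) [IsFiniteMeasure G] (x : ℝ) :
    Integrable (fun θ => gaussianPDFReal θ 1 x) G := by
  simpa using integrable_kernelMoment_integrand (k := 0) (by norm_num) G x

lemma measurable_kernelMoment (k : ℕ) (G : Measure ℝ) [SFinite G] :
    Measurable (kernelMoment k G) := by
  apply StronglyMeasurable.measurable
  apply StronglyMeasurable.integral_prod_right (f := fun (x θ : ℝ) => (θ - x) ^ k * gaussianPDFReal θ 1 x)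
  apply Measurable.stronglyMeasurable
  unfold Function.uncurry
  fun_prop

lemma measurable_mixtureDensity (G : Measure ℝ) [SFinite G] : Measurable (mixtureDensity G) := by
  have := measurable_kernelMoment 0 G
  rwa [funext (kernelMoment_zero G)] at this

lemma mixtureDensity_nonneg (G : Measure ℝ) (x : ℝ) : 0 ≤ mixtureDensity G x :=
  integral_nonneg fun _ => gaussianPDFReal_nonneg _ _ _

lemma mixtureDensity_pos (G : Measure ℝ) [IsProbabilityMeasure G] (x : ℝ) :
    0 < mixtureDensity G x := by
  rw [mixtureDensity, integral_pos_iff_support_of_nonneg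
    (fun _ => gaussianPDFReal_nonneg _ _ _) (integrable_gaussianPDFReal_mean G x)]
  have : Function.support (fun θ => gaussianPDFReal θ 1 x) = Set.univ :=
    Set.eq_univ_of_forall fun θ => (gaussianPDFReal_pos θ 1 x one_ne_zero).ne'
  simp [this]

lemma kernelMoment_mix {k : ℕ} (hk : k ≤ 2) {t : ℝ} (ht0 : 0 ≤ t) (ht1 : t ≤ 1)
    (G H : Measure ℝ) [IsFiniteMeasure G] [IsFiniteMeasure H] (x : ℝ) :
    kernelMoment k (ENNReal.ofReal (1 - t) • G + ENNReal.ofReal t • H) x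
      = (1 - t) * kernelMoment k G x + t * kernelMoment k H x := by
  have hG := integrable_kernelMoment_integrand hk G x
  have hH := integrable_kernelMoment_integrand hk H x
  rw [kernelMoment, integral_add_measure (hG.smul_measure ENNReal.ofReal_ne_top)
    (hH.smul_measure ENNReal.ofReal_ne_top), integral_smul_measure, integral_smul_measure,
    ENNReal.toReal_ofReal ht0, ENNReal.toReal_ofReal (by linarith)]
  rfl

lemma tendsto_kernelMoment {k : ℕ} (hk : k ≤ 2) {G : ℕ → ProbabilityMeasure ℝ}
    {G₀ : ProbabilityMeasure ℝ} (h : Tendsto G atTop (𝓝 G₀)) (x : ℝ) :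
    Tendsto (fun n => kernelMoment k (G n) x) atTop (𝓝 (kernelMoment k G₀ x)) := by
  let f : BoundedContinuousFunction ℝ ℝ := .ofNormedAddCommGroup _
    (continuous_kernelMoment_integrand k x) 2 (fun θ => abs_kernelMoment_integrand_le hk x θ)
  exact ProbabilityMeasure.tendsto_iff_forall_integral_tendsto.1 h f

/-- Tweedie's formula, since the first centred moment is f_G' (`deriv_mixtureDensity`). -/
lemma posteriorMean_eq (G : Measure ℝ) [IsProbabilityMeasure G] (x : ℝ) :
    posteriorMean G x = x + kernelMoment 1 G x / kernelMoment 0 G x := by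
  have hpos := mixtureDensity_pos G x
  have h1 : ∫ θ, θ * gaussianPDFReal θ 1 x ∂G = kernelMoment 1 G x + x * mixtureDensity G x := by
    rw [kernelMoment, mixtureDensity, ← integral_const_mul, ← integral_add
      (integrable_kernelMoment_integrand (by norm_num) G x)
      ((integrable_gaussianPDFReal_mean G x).const_mul x)]
    congr with θ
    ring
  rw [posteriorMean, h1, kernelMoment_zero]
  change _ / mixtureDensity G x = _
  field_simp
  ring

lemma measurable_posteriorMean (G : Measure ℝ) [IsProbabilityMeasure G] :
    Measurable (posteriorMean G) := by
  rw [funext (posteriorMean_eq G)]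
  exact measurable_id.add ((measurable_kernelMoment 1 G).div (measurable_kernelMoment 0 G))

lemma tendsto_posteriorMean {ι : Type*} {l : Filter ι} {G : ι → Measure ℝ} {G₀ : Measure ℝ}
    [∀ i, IsProbabilityMeasure (G i)] [IsProbabilityMeasure G₀] (x : ℝ)
    (h0 : Tendsto (fun i => kernelMoment 0 (G i) x) l (𝓝 (kernelMoment 0 G₀ x)))
    (h1 : Tendsto (fun i => kernelMoment 1 (G i) x) l (𝓝 (kernelMoment 1 G₀ x))) :
    Tendsto (fun i => posteriorMean (G i) x) l (𝓝 (posteriorMean G₀ x)) := by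
  simp only [posteriorMean_eq]
  refine tendsto_const_nhds.add (h1.div h0 ?_)
  rw [kernelMoment_zero]
  exact (mixtureDensity_pos G₀ x).ne'

/-! ### Bayes risk as an integral of conditional losses -/

lemma hasIntegral_sq_mul_gaussianPDFReal (G : Measure ℝ) [IsProbabilityMeasure G] (x a : ℝ) :
    Integrable (fun θ => (a - θ) ^ 2 * gaussianPDFReal θ 1 x) G ∧
      ∫ θ, (a - θ) ^ 2 * gaussianPDFReal θ 1 x ∂G = kernelMoment 2 G x
        - 2 * (a - x) * kernelMoment 1 G x + (a - x) ^ 2 * kernelMoment 0 G x := by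
  have i0 := (integrable_kernelMoment_integrand (k := 0) (by norm_num) G x).const_mul
    ((a - x) ^ 2)
  have i1 := (integrable_kernelMoment_integrand (k := 1) (by norm_num) G x).const_mul
    (2 * (a - x))
  have i2 := integrable_kernelMoment_integrand (k := 2) (by norm_num) G x
  have hs : (fun θ => (a - θ) ^ 2 * gaussianPDFReal θ 1 x) = fun θ =>
      (θ - x) ^ 2 * gaussianPDFReal θ 1 x
        - 2 * (a - x) * ((θ - x) ^ 1 * gaussianPDFReal θ 1 x)
        + (a - x) ^ 2 * ((θ - x) ^ 0 * gaussianPDFReal θ 1 x) := by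
    ext θ; ring
  rw [hs]
  refine ⟨(i2.sub i1).add i0, ?_⟩
  rw [integral_add (f := fun θ => (θ - x) ^ 2 * gaussianPDFReal θ 1 x
    - 2 * (a - x) * ((θ - x) ^ 1 * gaussianPDFReal θ 1 x)) (i2.sub i1) i0,
    integral_sub i2 i1, integral_const_mul, integral_const_mul]
  rfl

/-- Conditional expected loss at `x` of the action `a`, times the marginal density. -/
lemma lintegral_sq_mul_gaussianPDF (G : Measure ℝ) [IsProbabilityMeasure G] (x a : ℝ) :
    ∫⁻ θ, ENNReal.ofReal ((a - θ) ^ 2) * gaussianPDF θ 1 x ∂G =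
      ENNReal.ofReal (kernelMoment 2 G x - 2 * (a - x) * kernelMoment 1 G x
        + (a - x) ^ 2 * kernelMoment 0 G x) := by
  obtain ⟨hi, hv⟩ := hasIntegral_sq_mul_gaussianPDFReal G x a
  rw [← hv, ofReal_integral_eq_lintegral_ofReal hi
    (.of_forall fun θ => mul_nonneg (sq_nonneg _) (gaussianPDFReal_nonneg _ _ _))]
  simp only [gaussianPDF, ENNReal.ofReal_mul (sq_nonneg _)]

lemma pointwiseRisk_eq {δ : ℝ → ℝ} (hδ : Measurable δ) (θ : ℝ) :
    pointwiseRisk δ θ = ∫⁻ x, ENNReal.ofReal ((δ x - θ) ^ 2) * gaussianPDF θ 1 x := by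
  rw [pointwiseRisk, gaussianReal_of_var_ne_zero _ one_ne_zero,
    lintegral_withDensity_eq_lintegral_mul _ (measurable_gaussianPDF _ _) (by fun_prop)]
  simp [mul_comm]

lemma measurable_pointwiseRisk {δ : ℝ → ℝ} (hδ : Measurable δ) : Measurable (pointwiseRisk δ) := by
  rw [funext (pointwiseRisk_eq hδ)]
  apply Measurable.lintegral_prod_right
  unfold Function.uncurry
  fun_prop

lemma quadBayesRisk_eq (G : Measure ℝ) [IsProbabilityMeasure G] {δ : ℝ → ℝ} (hδ : Measurable δ) :
    quadBayesRisk G δ = ∫⁻ x, ENNReal.ofReal (kernelMoment 2 G x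
      - 2 * (δ x - x) * kernelMoment 1 G x + (δ x - x) ^ 2 * kernelMoment 0 G x) := by
  simp only [quadBayesRisk, pointwiseRisk_eq hδ]
  rw [lintegral_lintegral_swap (by unfold Function.uncurry; fun_prop)]
  simp only [lintegral_sq_mul_gaussianPDF]

/-- This is the posterior variance times the marginal density; nonnegativity keeps `ENNReal.ofReal`
from truncating. -/
lemma quadratic_kernelMoment_nonneg (G : Measure ℝ) [IsProbabilityMeasure G] (x : ℝ) :
    0 ≤ kernelMoment 2 G x - kernelMoment 1 G x ^ 2 / kernelMoment 0 G x := by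
  have hpos := mixtureDensity_pos G x
  rw [← kernelMoment_zero] at hpos
  have h0 : 0 ≤ ∫ θ, (x + kernelMoment 1 G x / kernelMoment 0 G x - θ) ^ 2
      * gaussianPDFReal θ 1 x ∂G :=
    integral_nonneg fun θ => mul_nonneg (sq_nonneg _) (gaussianPDFReal_nonneg _ _ _)
  rw [(hasIntegral_sq_mul_gaussianPDFReal G x _).2] at h0
  convert h0 using 1
  field_simp
  ring

/-- The Bayes risk of the Bayes rule. -/
lemma quadBayesRisk_posteriorMean (G : Measure ℝ) [IsProbabilityMeasure G] :
    quadBayesRisk G (posteriorMean G) = ∫⁻ x, ENNReal.ofReal (kernelMoment 2 G x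
      - kernelMoment 1 G x ^ 2 / kernelMoment 0 G x) := by
  rw [quadBayesRisk_eq G (measurable_posteriorMean G)]
  congr with x
  have hpos := mixtureDensity_pos G x
  rw [← kernelMoment_zero] at hpos
  rw [posteriorMean_eq]
  congr 1
  field_simp
  ring

/-- Pythagoras at each x: conditional loss is posterior variance plus squared distance to the
posterior mean. -/
lemma quadBayesRisk_eq_add (G : Measure ℝ) [IsProbabilityMeasure G] {δ : ℝ → ℝ}
    (hδ : Measurable δ) :
    quadBayesRisk G δ = quadBayesRisk G (posteriorMean G)
      + ∫⁻ x, ENNReal.ofReal ((δ x - posteriorMean G x) ^ 2 * mixtureDensity G x) := by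
  have hm := measurable_posteriorMean G
  have hm0 := measurable_mixtureDensity G
  rw [quadBayesRisk_eq G hδ, quadBayesRisk_posteriorMean, ← lintegral_add_right _ (by fun_prop)]
  congr with x
  have hpos := mixtureDensity_pos G x
  rw [← ENNReal.ofReal_add (quadratic_kernelMoment_nonneg G x) (by positivity), posteriorMean_eq,
    ← kernelMoment_zero]
  rw [← kernelMoment_zero] at hpos
  congr 1
  field_simp
  ring

lemma pointwiseRisk_id (θ : ℝ) : pointwiseRisk id θ = 1 := by
  have h := variance_fun_id_gaussianReal (μ := θ) (v := 1)
  rw [variance_eq_integral (by fun_prop)] at h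
  simp only [integral_id_gaussianReal] at h
  rw [pointwiseRisk, ← ofReal_integral_eq_lintegral_ofReal _ (.of_forall fun _ => sq_nonneg _)]
  · simpa using congrArg ENNReal.ofReal h
  · exact ((memLp_id_gaussianReal 2).sub (memLp_const θ)).integrable_sq

lemma quadBayesRisk_id (G : Measure ℝ) [IsProbabilityMeasure G] : quadBayesRisk G id = 1 := by
  simp [quadBayesRisk, pointwiseRisk_id]

lemma quadBayesRisk_posteriorMean_le (G : Measure ℝ) [IsProbabilityMeasure G] {δ : ℝ → ℝ}
    (hδ : Measurable δ) : quadBayesRisk G (posteriorMean G) ≤ quadBayesRisk G δ := by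
  rw [quadBayesRisk_eq_add G hδ]
  exact le_self_add

lemma quadBayesRisk_posteriorMean_le_one (G : Measure ℝ) [IsProbabilityMeasure G] :
    quadBayesRisk G (posteriorMean G) ≤ 1 :=
  (quadBayesRisk_posteriorMean_le G measurable_id).trans (quadBayesRisk_id G).le

/-! ### Fisher information -/

lemma deriv_mixtureDensity (G : Measure ℝ) [IsProbabilityMeasure G] (x : ℝ) :
    deriv (mixtureDensity G) x = kernelMoment 1 G x := by
  have h := hasDerivAt_integral_of_dominated_loc_of_deriv_le (μ := G)
    (F := fun x θ => gaussianPDFReal θ 1 x)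
    (F' := fun x θ => (θ - x) ^ 1 * gaussianPDFReal θ 1 x) (x₀ := x) (s := Set.univ)
    (bound := fun _ => 2) univ_mem
    (.of_forall fun y => (integrable_gaussianPDFReal_mean G y).aestronglyMeasurable)
    (integrable_gaussianPDFReal_mean G x)
    (integrable_kernelMoment_integrand (by norm_num) G x).aestronglyMeasurable
    (.of_forall fun θ y _ => abs_kernelMoment_integrand_le (by norm_num) y θ)
    (integrable_const _) (.of_forall fun θ y _ => ?_)
  · exact h.2.deriv
  · simp only [gaussianPDFReal_one]
    have h1 : HasDerivAt (fun y : ℝ => -(y - θ) ^ 2 / 2) (θ - y) y := by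
      refine ((((hasDerivAt_id y).sub_const θ).pow 2).neg.div_const 2).congr_deriv ?_
      simp
      ring
    refine (h1.exp.const_mul (√(2 * Real.pi))⁻¹).congr_deriv ?_
    ring

/-- Brown's identity: Fisher information and Bayes risk add up to one. -/
lemma quadBayesRisk_add_fisherInfo (G : Measure ℝ) [IsProbabilityMeasure G] :
    quadBayesRisk G (posteriorMean G) + fisherInfo (mixtureDensity G) = 1 := by
  -- Pythagoras for the rule x ↦ x, which has risk one and differs from the posterior mean by -f'/f.
  rw [← quadBayesRisk_id G, quadBayesRisk_eq_add G measurable_id, fisherInfo]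
  congr 2 with x
  have hpos := mixtureDensity_pos G x
  rw [deriv_mixtureDensity, posteriorMean_eq, ← kernelMoment_zero]
  rw [← kernelMoment_zero] at hpos
  congr 1
  simp only [id]
  field_simp
  ring

/-! ### The contamination class -/

lemma isProbabilityMeasure_mix {t : ℝ} (ht0 : 0 ≤ t) (ht1 : t ≤ 1) (G H : Measure ℝ)
    [IsProbabilityMeasure G] [IsProbabilityMeasure H] :
    IsProbabilityMeasure (ENNReal.ofReal (1 - t) • G + ENNReal.ofReal t • H) := by
  constructor
  simp [← ENNReal.ofReal_add (sub_nonneg.2 ht1) ht0]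

lemma isProbabilityMeasure_of_mem_contaminationClass {ε : ℝ} (hε0 : 0 ≤ ε) (hε1 : ε ≤ 1)
    {G : ProbabilityMeasure ℝ} {K : Measure ℝ} (hK : K ∈ contaminationClass ε G) :
    IsProbabilityMeasure K := by
  obtain ⟨H, rfl⟩ := hK
  exact isProbabilityMeasure_mix hε0 hε1 _ _

lemma mix_mem_contaminationClass {ε t : ℝ} (ht0 : 0 ≤ t) (ht1 : t ≤ 1)
    {G : ProbabilityMeasure ℝ} {K₁ K₂ : Measure ℝ} (h₁ : K₁ ∈ contaminationClass ε G)
    (h₂ : K₂ ∈ contaminationClass ε G) :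
    ENNReal.ofReal (1 - t) • K₁ + ENNReal.ofReal t • K₂ ∈ contaminationClass ε G := by
  obtain ⟨H₁, rfl⟩ := h₁
  obtain ⟨H₂, rfl⟩ := h₂
  have hsum : ENNReal.ofReal (1 - t) + ENNReal.ofReal t = 1 := by
    simp [← ENNReal.ofReal_add (sub_nonneg.2 ht1) ht0]
  refine ⟨⟨_, isProbabilityMeasure_mix ht0 ht1 (H₁ : Measure ℝ) H₂⟩, ?_⟩
  rw [ProbabilityMeasure.coe_mk]
  set p := ENNReal.ofReal (1 - t)
  set q := ENNReal.ofReal t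
  calc p • (ENNReal.ofReal (1 - ε) • (G : Measure ℝ) + ENNReal.ofReal ε • (H₁ : Measure ℝ))
        + q • (ENNReal.ofReal (1 - ε) • (G : Measure ℝ) + ENNReal.ofReal ε • (H₂ : Measure ℝ))
      = (p + q) • ENNReal.ofReal (1 - ε) • (G : Measure ℝ)
        + ENNReal.ofReal ε • (p • (H₁ : Measure ℝ) + q • (H₂ : Measure ℝ)) := by module
    _ = _ := by rw [hsum, one_smul]

lemma quadBayesRisk_mix (a b : ℝ≥0∞) (G H : Measure ℝ) (δ : ℝ → ℝ) :
    quadBayesRisk (a • G + b • H) δ = a * quadBayesRisk G δ + b * quadBayesRisk H δ := by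
  simp [quadBayesRisk, lintegral_add_measure, lintegral_smul_measure]

/-! ### Semicontinuity of the Bayes risk -/

lemma quadBayesRisk_le_liminf (G : Measure ℝ) [IsProbabilityMeasure G] {δ : ℕ → ℝ → ℝ}
    {δ₀ : ℝ → ℝ} (hδ : ∀ n, Measurable (δ n)) (hδ₀ : Measurable δ₀)
    (h : ∀ x, Tendsto (fun n => δ n x) atTop (𝓝 (δ₀ x))) :
    quadBayesRisk G δ₀ ≤ liminf (fun n => quadBayesRisk G (δ n)) atTop := by
  have m0 := measurable_kernelMoment 0 G
  have m1 := measurable_kernelMoment 1 G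
  have m2 := measurable_kernelMoment 2 G
  rw [quadBayesRisk_eq G hδ₀]
  simp only [fun n => quadBayesRisk_eq G (hδ n)]
  refine le_trans (lintegral_mono fun x => ?_) (lintegral_liminf_le fun n => by fun_prop)
  refine (Tendsto.liminf_eq ?_).ge
  refine ENNReal.tendsto_ofReal ?_
  have hx := (h x).sub_const x
  exact (tendsto_const_nhds.sub ((hx.const_mul 2).mul_const _)).add ((hx.pow 2).mul_const _)

/-- Fatou applied to posterior variance times density, a continuous function of the three moments
because the density is positive. -/
lemma quadBayesRisk_posteriorMean_le_liminf {G : ℕ → ProbabilityMeasure ℝ}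
    {G₀ : ProbabilityMeasure ℝ}
    (h : ∀ k ≤ 2, ∀ x, Tendsto (fun n => kernelMoment k (G n) x) atTop (𝓝 (kernelMoment k G₀ x))) :
    quadBayesRisk G₀ (posteriorMean G₀) ≤
      liminf (fun n => quadBayesRisk (G n) (posteriorMean (G n))) atTop := by
  simp only [quadBayesRisk_posteriorMean]
  refine le_trans (lintegral_mono fun x => ?_) (lintegral_liminf_le fun n => ?_)
  · refine (Tendsto.liminf_eq ?_).ge
    refine ENNReal.tendsto_ofReal ?_
    refine (h 2 le_rfl x).sub (((h 1 (by norm_num) x).pow 2).div (h 0 (by norm_num) x) ?_)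
    rw [kernelMoment_zero]
    exact (mixtureDensity_pos _ x).ne'
  · have m0 := measurable_kernelMoment 0 (G n : Measure ℝ)
    have m1 := measurable_kernelMoment 1 (G n : Measure ℝ)
    have m2 := measurable_kernelMoment 2 (G n : Measure ℝ)
    fun_prop

/-! ### The saddle point property of Mallows rules -/

lemma quadBayesRisk_posteriorMean_anti {G H : Measure ℝ} [IsProbabilityMeasure G]
    [IsProbabilityMeasure H]
    (h : fisherInfo (mixtureDensity G) ≤ fisherInfo (mixtureDensity H)) :
    quadBayesRisk H (posteriorMean H) ≤ quadBayesRisk G (posteriorMean G) := by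
  have hG := quadBayesRisk_add_fisherInfo G
  have hH := quadBayesRisk_add_fisherInfo H
  have hfin : fisherInfo (mixtureDensity G) ≠ ∞ :=
    ne_top_of_le_ne_top ENNReal.one_ne_top (hG ▸ le_add_self)
  refine (ENNReal.add_le_add_iff_right hfin).1 ?_
  rw [hG, ← hH]
  gcongr

/-- The Mallows prior is least favorable for its posterior mean in the contamination class. -/
lemma IsMallowsPrior.quadBayesRisk_le {ε : ℝ} (hε0 : 0 ≤ ε) (hε1 : ε ≤ 1)
    {G : ProbabilityMeasure ℝ} {G' K : Measure ℝ} (hG' : IsMallowsPrior ε G G')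
    (hK : K ∈ contaminationClass ε G) :
    quadBayesRisk K (posteriorMean G') ≤ quadBayesRisk G' (posteriorMean G') := by
  have hPG := isProbabilityMeasure_of_mem_contaminationClass hε0 hε1 hG'.1
  have hPK := isProbabilityMeasure_of_mem_contaminationClass hε0 hε1 hK
  -- Move from G' towards K by a vanishing weight t; convexity keeps the mixture in the class.
  let t : ℕ → ℝ := fun n => 1 / ((n : ℝ) + 1)
  have ht0 : ∀ n, 0 < t n := fun n => by positivity
  have ht1 : ∀ n, t n ≤ 1 := fun n => by
    simp only [t]
    rw [div_le_one (by positivity)]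
    linarith [(Nat.cast_nonneg n : (0 : ℝ) ≤ n)]
  have ht : Tendsto t atTop (𝓝 0) := tendsto_one_div_add_atTop_nhds_zero_nat
  let M : ℕ → Measure ℝ := fun n => ENNReal.ofReal (1 - t n) • G' + ENNReal.ofReal (t n) • K
  have hPM : ∀ n, IsProbabilityMeasure (M n) := fun n =>
    isProbabilityMeasure_mix (ht0 n).le (ht1 n) _ _
  have hmom : ∀ k ≤ 2, ∀ x, Tendsto (fun n => kernelMoment k (M n) x) atTop
      (𝓝 (kernelMoment k G' x)) := by
    intro k hk x
    simp only [M, fun n => kernelMoment_mix hk (ht0 n).le (ht1 n) G' K x]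
    simpa using ((ht.const_sub 1).mul_const (kernelMoment k G' x)).add
      (ht.mul_const (kernelMoment k K x))
  have hfin : quadBayesRisk G' (posteriorMean G') ≠ ∞ :=
    ne_top_of_le_ne_top ENNReal.one_ne_top (quadBayesRisk_posteriorMean_le_one G')
  have hle : ∀ n, quadBayesRisk K (posteriorMean (M n)) ≤ quadBayesRisk G' (posteriorMean G') := by
    intro n
    have h1 := quadBayesRisk_posteriorMean_anti
      (hG'.2 _ (mix_mem_contaminationClass (ht0 n).le (ht1 n) hG'.1 hK))
    change quadBayesRisk (M n) (posteriorMean (M n)) ≤ _ at h1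
    have h2 := quadBayesRisk_posteriorMean_le G' (measurable_posteriorMean (M n))
    set B := quadBayesRisk G' (posteriorMean G') with hB
    set R := quadBayesRisk K (posteriorMean (M n)) with hR
    have h3 : quadBayesRisk (M n) (posteriorMean (M n)) = ENNReal.ofReal (1 - t n) *
      quadBayesRisk G' (posteriorMean (M n)) + ENNReal.ofReal (t n) * R := quadBayesRisk_mix _ _ _ _ _
    rw [h3] at h1
    -- B is at most the risk of any rule under G', and B(M n) ≤ B by maximality; cancelling the
    -- first term and dividing by t leaves R ≤ B.
    have h4 : ENNReal.ofReal (1 - t n) * B + ENNReal.ofReal (t n) * R ≤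
        ENNReal.ofReal (1 - t n) * B + ENNReal.ofReal (t n) * B := by
      refine le_trans (by gcongr) (h1.trans_eq ?_)
      rw [← add_mul, ← ENNReal.ofReal_add (sub_nonneg.2 (ht1 n)) (ht0 n).le]
      simp
    have h5 := (ENNReal.add_le_add_iff_left (ENNReal.mul_ne_top ENNReal.ofReal_ne_top hfin)).1 h4
    exact (ENNReal.mul_le_mul_iff_right (by simpa using ht0 n) ENNReal.ofReal_ne_top).1 h5
  refine (quadBayesRisk_le_liminf K (fun n => measurable_posteriorMean (M n))
    (measurable_posteriorMean G') fun x => tendsto_posteriorMean x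
      (hmom 0 (by norm_num) x) (hmom 1 (by norm_num) x)).trans ?_
  refine (liminf_le_liminf (.of_forall hle)).trans ?_
  simp

lemma IsMallowsRule.measurable {ε : ℝ} (hε0 : 0 ≤ ε) (hε1 : ε ≤ 1)
    {G : ProbabilityMeasure ℝ} {δ : ℝ → ℝ} (h : IsMallowsRule ε G δ) : Measurable δ := by
  obtain ⟨G', hG', rfl⟩ := h
  have := isProbabilityMeasure_of_mem_contaminationClass hε0 hε1 hG'.1
  exact measurable_posteriorMean G'

/-- The risk function of a Mallows rule is bounded. -/
lemma IsMallowsRule.pointwiseRisk_le {ε : ℝ} (hε0 : 0 < ε) (hε1 : ε ≤ 1)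
    {G : ProbabilityMeasure ℝ} {δ : ℝ → ℝ} (h : IsMallowsRule ε G δ) (θ : ℝ) :
    pointwiseRisk δ θ ≤ ENNReal.ofReal (1 / ε) := by
  have hm := h.measurable hε0.le hε1
  obtain ⟨G', hG', rfl⟩ := h
  have := isProbabilityMeasure_of_mem_contaminationClass hε0.le hε1 hG'.1
  -- With contamination by a point mass at θ, the saddle inequality gives ε R(δ, θ) ≤ B(G') ≤ 1.
  have h1 := hG'.quadBayesRisk_le hε0.le hε1
    (K := ENNReal.ofReal (1 - ε) • (G : Measure ℝ) + ENNReal.ofReal ε • Measure.dirac θ)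
    ⟨⟨Measure.dirac θ, inferInstance⟩, rfl⟩
  have h2 := h1.trans (quadBayesRisk_posteriorMean_le_one G')
  rw [quadBayesRisk_mix] at h2
  have h3 := le_trans le_add_self h2
  rw [quadBayesRisk, lintegral_dirac' _ (measurable_pointwiseRisk hm)] at h3
  rw [one_div, ENNReal.ofReal_inv_of_pos hε0]
  rwa [ENNReal.le_inv_iff_mul_le, mul_comm]

lemma quadBayesRisk_le_of_pointwiseRisk_le {C : ℝ≥0∞} {δ : ℝ → ℝ}
    (h : ∀ θ, pointwiseRisk δ θ ≤ C) (G : Measure ℝ) [IsProbabilityMeasure G] :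
    quadBayesRisk G δ ≤ C :=
  (lintegral_mono h).trans (by simp)

/-! ### Hellinger convergence of mixtures implies weak convergence of mixing distributions -/

lemma integrable_gaussianPDFReal_prod (G : Measure ℝ) [IsProbabilityMeasure G] :
    Integrable (fun p : ℝ × ℝ => gaussianPDFReal p.1 1 p.2) (G.prod volume) := by
  rw [integrable_prod_iff (by fun_prop)]
  refine ⟨.of_forall fun θ => integrable_gaussianPDFReal θ 1, ?_⟩
  simp [Real.norm_of_nonneg (gaussianPDFReal_nonneg _ _ _), integral_gaussianPDFReal_eq_one]

lemma integrable_mixtureDensity (G : Measure ℝ) [IsProbabilityMeasure G] :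
    Integrable (mixtureDensity G) :=
  (integrable_gaussianPDFReal_prod G).integral_prod_right

lemma integral_mixtureDensity (G : Measure ℝ) [IsProbabilityMeasure G] :
    ∫ x, mixtureDensity G x = 1 := by
  simp only [mixtureDensity]
  rw [← integral_integral_swap (integrable_gaussianPDFReal_prod G)]
  simp [integral_gaussianPDFReal_eq_one]

lemma norm_cexp_mul_mul_I (t x : ℝ) : ‖Complex.exp (t * x * Complex.I)‖ = 1 := by
  rw [← Complex.ofReal_mul, Complex.norm_exp_ofReal_mul_I]

/-- Convolution becomes a product; the Gaussian factor never vanishes, so it can be divided out at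
each fixed t. -/
lemma integral_cexp_mul_mixtureDensity (G : Measure ℝ) [IsProbabilityMeasure G] (t : ℝ) :
    ∫ x : ℝ, Complex.exp (t * x * Complex.I) * (mixtureDensity G x : ℂ) =
      charFun G t * Complex.exp (-t ^ 2 / 2) := by
  have hi : Integrable (Function.uncurry fun (θ x : ℝ) =>
      Complex.exp (t * x * Complex.I) * (gaussianPDFReal θ 1 x : ℂ)) (G.prod volume) := by
    refine (integrable_gaussianPDFReal_prod G).ofReal.bdd_mul (c := 1) ?_ ?_
    · fun_prop
    · exact .of_forall fun p => (norm_cexp_mul_mul_I t p.2).le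
  have h := integral_integral_swap hi
  simp only [integral_const_mul, integral_complex_ofReal] at h
  change ∫ x : ℝ, _ * ((∫ θ, gaussianPDFReal θ 1 x ∂G : ℝ) : ℂ) = _
  rw [← h, charFun_apply_real, ← integral_mul_const]
  congr with θ
  have h1 := charFun_gaussianReal (μ := θ) (v := 1) t
  rw [charFun_apply_real, integral_gaussianReal_eq_integral_smul one_ne_zero] at h1
  rw [← Complex.exp_add]
  convert h1 using 2
  · ext x; rw [mul_comm]; simp
  · push_cast; ring

/-- Factor a - b through the square roots and apply AM-GM with weight s, a substitute for
Cauchy-Schwarz in the integral bound below. -/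
lemma abs_sub_le_sq_sqrt_sub {a b s : ℝ} (ha : 0 ≤ a) (hb : 0 ≤ b) (hs : 0 < s) :
    |a - b| ≤ (2 * s)⁻¹ * (√a - √b) ^ 2 + s * (a + b) := by
  obtain ⟨u, hu, rfl⟩ : ∃ u, 0 ≤ u ∧ a = u ^ 2 := ⟨√a, Real.sqrt_nonneg a, (Real.sq_sqrt ha).symm⟩
  obtain ⟨v, hv, rfl⟩ : ∃ v, 0 ≤ v ∧ b = v ^ 2 := ⟨√b, Real.sqrt_nonneg b, (Real.sq_sqrt hb).symm⟩
  rw [Real.sqrt_sq hu, Real.sqrt_sq hv, show u ^ 2 - v ^ 2 = (u - v) * (u + v) by ring, abs_mul,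
    abs_of_nonneg (by positivity : 0 ≤ u + v)]
  have h1 : |u - v| * (u + v) ≤ (2 * s)⁻¹ * |u - v| ^ 2 + s / 2 * (u + v) ^ 2 := by
    have h2 : (2 * s)⁻¹ * |u - v| ^ 2 + s / 2 * (u + v) ^ 2 - |u - v| * (u + v)
      = (2 * s)⁻¹ * (|u - v| - s * (u + v)) ^ 2 := by
      field_simp
      ring
    have h3 : 0 ≤ (2 * s)⁻¹ * (|u - v| - s * (u + v)) ^ 2 := by positivity
    linarith
  rw [sq_abs] at h1
  nlinarith [sq_nonneg (u - v)]

/-- The `L¹` distance of two densities is controlled by their Hellinger distance. -/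
lemma integral_abs_sub_le_hellingerDist {f g : ℝ → ℝ} (hf : Integrable f) (hg : Integrable g)
    (hf0 : ∀ x, 0 ≤ f x) (hg0 : ∀ x, 0 ≤ g x) (hf1 : ∫ x, f x = 1) (hg1 : ∫ x, g x = 1) :
    ∫ x, |f x - g x| ≤ 3 * hellingerDist f g := by
  have hI : Integrable fun x => (√(f x) - √(g x)) ^ 2 := by
    refine Integrable.mono' ((hf.add hg).const_mul 2) ?_ (.of_forall fun x => ?_)
    · exact (((continuous_id.sqrt).comp_aestronglyMeasurable hf.1).sub
        ((continuous_id.sqrt).comp_aestronglyMeasurable hg.1)).pow 2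
    · rw [Real.norm_of_nonneg (sq_nonneg _)]
      have h1 := Real.sq_sqrt (hf0 x)
      have h2 := Real.sq_sqrt (hg0 x)
      simp only [Pi.add_apply]
      nlinarith [sq_nonneg (√(f x) + √(g x))]
  have hH : ∫ x, (√(f x) - √(g x)) ^ 2 = 2 * hellingerDist f g ^ 2 := by
    rw [hellingerDist, Real.sq_sqrt]
    · ring
    · have : 0 ≤ ∫ x, (√(f x) - √(g x)) ^ 2 := integral_nonneg fun _ => sq_nonneg _
      positivity
  have key : ∀ s > 0, ∫ x, |f x - g x| ≤ s⁻¹ * hellingerDist f g ^ 2 + 2 * s := by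
    intro s hs
    calc ∫ x, |f x - g x|
        ≤ ∫ x, ((2 * s)⁻¹ * (√(f x) - √(g x)) ^ 2 + s * (f x + g x)) :=
          integral_mono (hf.sub hg).abs ((hI.const_mul _).add ((hf.add hg).const_mul s))
            fun x => abs_sub_le_sq_sqrt_sub (hf0 x) (hg0 x) hs
      _ = (2 * s)⁻¹ * (2 * hellingerDist f g ^ 2) + s * (1 + 1) := by
          rw [integral_add (g := fun x => s * (f x + g x)) (hI.const_mul _)
            ((hf.add hg).const_mul s), integral_const_mul,
            integral_const_mul, hH, integral_add hf hg, hf1, hg1]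
      _ = _ := by
          field_simp
          ring
  have h0 : 0 ≤ hellingerDist f g := Real.sqrt_nonneg _
  -- The choice s = h gives the constant 3; if the distance is zero, let s tend to 0.
  rcases h0.eq_or_lt with h | h
  · rw [← h] at key ⊢
    refine le_of_forall_pos_le_add fun s hs => ?_
    have := key (s / 2) (by positivity)
    simp at this ⊢
    linarith
  · have := key _ h
    have h2 : (hellingerDist f g)⁻¹ * hellingerDist f g ^ 2 = hellingerDist f g := by field_simp
    linarith

lemma norm_charFun_sub_le (G H : Measure ℝ) [IsProbabilityMeasure G] [IsProbabilityMeasure H]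
    (t : ℝ) : ‖charFun G t - charFun H t‖ ≤
      Real.exp (t ^ 2 / 2) * (3 * hellingerDist (mixtureDensity G) (mixtureDensity H)) := by
  have hG := integral_cexp_mul_mixtureDensity G t
  have hH := integral_cexp_mul_mixtureDensity H t
  have iG := integrable_mixtureDensity G
  have iH := integrable_mixtureDensity H
  have hi : ∀ {f : ℝ → ℝ}, Integrable f →
      Integrable fun x : ℝ => Complex.exp (t * x * Complex.I) * (f x : ℂ) := fun hf =>
    hf.ofReal.bdd_mul (c := 1) (by fun_prop) (.of_forall fun x => (norm_cexp_mul_mul_I t x).le)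
  have hd : charFun G t - charFun H t = Complex.exp ((t ^ 2 / 2 : ℝ)) *
      ∫ x : ℝ, Complex.exp (t * x * Complex.I) * ((mixtureDensity G x - mixtureDensity H x : ℝ) : ℂ) := by
    have he : Complex.exp ((t ^ 2 / 2 : ℝ)) * Complex.exp (-t ^ 2 / 2) = 1 := by
      rw [← Complex.exp_add, ← Complex.exp_zero]
      congr 1
      push_cast
      ring
    simp only [Complex.ofReal_sub, mul_sub]
    rw [integral_sub (hi iG) (hi iH), hG, hH]
    linear_combination (charFun H t - charFun G t) * he
  rw [hd, norm_mul, ← Complex.ofReal_exp, Complex.norm_of_nonneg (Real.exp_pos _).le]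
  gcongr
  refine le_trans (norm_integral_le_integral_norm _) (le_trans (le_of_eq ?_)
    (integral_abs_sub_le_hellingerDist iG iH (mixtureDensity_nonneg G) (mixtureDensity_nonneg H)
      (integral_mixtureDensity G) (integral_mixtureDensity H)))
  congr with x
  rw [norm_mul, norm_cexp_mul_mul_I, one_mul, Complex.norm_real, Real.norm_eq_abs]

lemma tendsto_of_tendsto_hellingerDist {G : ℕ → ProbabilityMeasure ℝ} {G₀ : ProbabilityMeasure ℝ}
    (h : Tendsto (fun n => hellingerDist (mixtureDensity (G n)) (mixtureDensity G₀)) atTop (𝓝 0)) :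
    Tendsto G atTop (𝓝 G₀) := by
  refine ProbabilityMeasure.tendsto_of_tendsto_charFun fun t => ?_
  rw [tendsto_iff_norm_sub_tendsto_zero]
  refine squeeze_zero (fun _ => norm_nonneg _) (fun n => norm_charFun_sub_le _ _ t) ?_
  simpa using (h.const_mul 3).const_mul (Real.exp (t ^ 2 / 2))

/-! ### Domination of translated kernels and continuity of risk functions -/

/-- Compare with the kernel shifted by one towards x. Shifts |s| ≤ 1 give a local majorant in θ, and
s = 0 gives exponential decay of the tail. -/
lemma gaussianPDFReal_add_le (s θ x : ℝ) :
    gaussianPDFReal (θ + s) 1 x ≤ Real.exp (1 / 2 - (1 - |s|) * |x - θ|) *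
      (gaussianPDFReal (θ + 1) 1 x + gaussianPDFReal (θ - 1) 1 x) := by
  simp only [gaussianPDFReal_one]
  rw [← mul_add, mul_left_comm]
  refine mul_le_mul_of_nonneg_left ?_ (by positivity)
  rw [mul_add, ← Real.exp_add, ← Real.exp_add]
  have h1 : (x - θ) * s ≤ |x - θ| * |s| := by
    rw [← abs_mul]; exact le_abs_self _
  rcases abs_cases (x - θ) with ⟨h, _⟩ | ⟨h, _⟩
  · refine le_trans (Real.exp_le_exp.2 ?_) (le_add_of_nonneg_right (Real.exp_pos _).le)
    rw [h] at h1 ⊢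
    nlinarith [sq_nonneg s]
  · refine le_trans (Real.exp_le_exp.2 ?_) (le_add_of_nonneg_left (Real.exp_pos _).le)
    rw [h] at h1 ⊢
    nlinarith [sq_nonneg s]

lemma gaussianPDF_add_le (s θ x : ℝ) :
    gaussianPDF (θ + s) 1 x ≤ ENNReal.ofReal (Real.exp (1 / 2 - (1 - |s|) * |x - θ|)) *
      (gaussianPDF (θ + 1) 1 x + gaussianPDF (θ - 1) 1 x) := by
  simp only [gaussianPDF]
  rw [← ENNReal.ofReal_add (gaussianPDFReal_nonneg _ _ _) (gaussianPDFReal_nonneg _ _ _),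
    ← ENNReal.ofReal_mul (Real.exp_pos _).le]
  exact ENNReal.ofReal_le_ofReal (gaussianPDFReal_add_le s θ x)

lemma lintegral_sq_add_const_mul_gaussianPDF {δ : ℝ → ℝ} (hδ : Measurable δ) (θ c : ℝ)
    (hc : 0 ≤ c) :
    ∫⁻ x, ENNReal.ofReal (2 * (δ x - θ) ^ 2 + c) * gaussianPDF θ 1 x =
      2 * pointwiseRisk δ θ + ENNReal.ofReal c := by
  have h : ∀ x, ENNReal.ofReal (2 * (δ x - θ) ^ 2 + c) * gaussianPDF θ 1 x =
      2 * (ENNReal.ofReal ((δ x - θ) ^ 2) * gaussianPDF θ 1 x)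
        + ENNReal.ofReal c * gaussianPDF θ 1 x := fun x => by
    rw [ENNReal.ofReal_add (by positivity) hc, ENNReal.ofReal_mul zero_le_two, add_mul, mul_assoc]
    simp
  simp only [h]
  rw [lintegral_add_left (by fun_prop), lintegral_const_mul _ (by fun_prop),
    lintegral_const_mul _ (by fun_prop), lintegral_gaussianPDF_eq_one _ one_ne_zero, mul_one,
    pointwiseRisk_eq hδ]

lemma continuous_pointwiseRisk {δ : ℝ → ℝ} (hδ : Measurable δ)
    (hfin : ∀ θ, pointwiseRisk δ θ ≠ ∞) : Continuous (pointwiseRisk δ) := by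
  rw [continuous_iff_continuousAt]
  intro θ
  rw [ContinuousAt, funext (pointwiseRisk_eq hδ)]
  -- The 8 comes from (u + v)² ≤ 2u² + 2v² with |v| ≤ 2, the largest distance from a nearby location
  -- to θ ± 1.
  refine tendsto_lintegral_filter_of_dominated_convergence
    (fun x => ENNReal.ofReal (Real.exp (1 / 2)) *
      (ENNReal.ofReal (2 * (δ x - (θ + 1)) ^ 2 + 8) * gaussianPDF (θ + 1) 1 x
        + ENNReal.ofReal (2 * (δ x - (θ - 1)) ^ 2 + 8) * gaussianPDF (θ - 1) 1 x))
    (.of_forall fun θ' => by fun_prop) ?_ ?_ (.of_forall fun x => ?_)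
  · filter_upwards [Metric.ball_mem_nhds θ one_pos] with θ' hθ'
    refine .of_forall fun x => ?_
    have hs : |θ' - θ| ≤ 1 := (Metric.mem_ball.1 hθ').le
    obtain ⟨s, rfl⟩ : ∃ s, θ' = θ + s := ⟨θ' - θ, by ring⟩
    rw [add_sub_cancel_left] at hs
    obtain ⟨hs1, hs2⟩ := abs_le.1 hs
    have h1 : gaussianPDF (θ + s) 1 x ≤ ENNReal.ofReal (Real.exp (1 / 2)) *
      (gaussianPDF (θ + 1) 1 x + gaussianPDF (θ - 1) 1 x) := by
      refine (gaussianPDF_add_le s θ x).trans ?_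
      gcongr
      nlinarith [abs_nonneg (x - θ)]
    have h2 : (δ x - (θ + s)) ^ 2 ≤ 2 * (δ x - (θ + 1)) ^ 2 + 8 := by
      nlinarith [sq_nonneg (δ x - (θ + 1) - (1 - s))]
    have h3 : (δ x - (θ + s)) ^ 2 ≤ 2 * (δ x - (θ - 1)) ^ 2 + 8 := by
      nlinarith [sq_nonneg (δ x - (θ - 1) + (1 + s))]
    calc _ ≤ ENNReal.ofReal ((δ x - (θ + s)) ^ 2) * (ENNReal.ofReal (Real.exp (1 / 2)) *
          (gaussianPDF (θ + 1) 1 x + gaussianPDF (θ - 1) 1 x)) := by gcongr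
      _ = ENNReal.ofReal (Real.exp (1 / 2)) *
          (ENNReal.ofReal ((δ x - (θ + s)) ^ 2) * gaussianPDF (θ + 1) 1 x
            + ENNReal.ofReal ((δ x - (θ + s)) ^ 2) * gaussianPDF (θ - 1) 1 x) := by ring
      _ ≤ _ := by gcongr
  · rw [lintegral_const_mul _ (by fun_prop), lintegral_add_left (by fun_prop),
      lintegral_sq_add_const_mul_gaussianPDF hδ _ _ (by norm_num),
      lintegral_sq_add_const_mul_gaussianPDF hδ _ _ (by norm_num)]
    finiteness [hfin (θ + 1), hfin (θ - 1)]
  · have hc : Continuous fun θ' : ℝ => (δ x - θ') ^ 2 * gaussianPDFReal θ' 1 x := by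
      simp only [gaussianPDFReal_one]
      fun_prop
    simp only [gaussianPDF, ← ENNReal.ofReal_mul (sq_nonneg _)]
    exact ENNReal.tendsto_ofReal (hc.tendsto θ)

/-- A bounded risk function is continuous, hence a test function for weak convergence. -/
lemma tendsto_quadBayesRisk {δ : ℝ → ℝ} (hδ : Measurable δ) {C : ℝ}
    (hC : ∀ θ, pointwiseRisk δ θ ≤ ENNReal.ofReal C) {G : ℕ → ProbabilityMeasure ℝ}
    {G₀ : ProbabilityMeasure ℝ} (h : Tendsto G atTop (𝓝 G₀)) :
    Tendsto (fun n => (quadBayesRisk (G n) δ).toReal) atTop (𝓝 (quadBayesRisk G₀ δ).toReal) := by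
  have hfin : ∀ θ, pointwiseRisk δ θ ≠ ∞ := fun θ => ne_top_of_le_ne_top ENNReal.ofReal_ne_top (hC θ)
  have hcont : Continuous fun θ => (pointwiseRisk δ θ).toReal :=
    ENNReal.continuousOn_toReal.comp_continuous (continuous_pointwiseRisk hδ hfin) hfin
  let f : BoundedContinuousFunction ℝ ℝ := .ofNormedAddCommGroup _ hcont (max C 0) (fun θ => by
    rw [Real.norm_of_nonneg ENNReal.toReal_nonneg, ← ENNReal.toReal_ofReal']
    exact ENNReal.toReal_mono ENNReal.ofReal_ne_top (hC θ))
  have key : ∀ H : ProbabilityMeasure ℝ, (quadBayesRisk H δ).toReal = ∫ θ, f θ ∂(H : Measure ℝ) :=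
    fun H => (integral_toReal (measurable_pointwiseRisk hδ).aemeasurable
      (.of_forall fun θ => (hfin θ).lt_top)).symm
  simp only [key]
  exact ProbabilityMeasure.tendsto_iff_forall_integral_tendsto.1 h f

/-! ### Consistency of Mallows rules -/

/-- By the portmanteau theorem a ball charged by G₀ eventually keeps mass at least m; on it the
kernel is at least c₀, its value at the largest possible distance. -/
lemma exists_le_mixtureDensity {G : ℕ → ProbabilityMeasure ℝ} {G₀ : ProbabilityMeasure ℝ}
    (h : Tendsto G atTop (𝓝 G₀)) (θ L : ℝ) :
    ∃ c > 0, ∀ᶠ n in atTop, ∀ x, |x - θ| ≤ L → c ≤ mixtureDensity (G n) x := by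
  obtain ⟨A, hA⟩ : ∃ A : ℕ, (G₀ : Measure ℝ) (Metric.ball 0 A) ≠ 0 := by
    by_contra! hcon
    have := measure_iUnion_null hcon
    rw [Metric.iUnion_ball_nat] at this
    simp at this
  obtain ⟨m, hm0, hm⟩ := exists_between (pos_iff_ne_zero.2 hA)
  have hlim := eventually_lt_of_lt_liminf (hm.trans_le
    (ProbabilityMeasure.le_liminf_measure_open_of_tendsto h (Metric.isOpen_ball (x := 0) (ε := A))))
  set c₀ : ℝ := (√(2 * Real.pi))⁻¹ * Real.exp (-(|θ| + |L| + A) ^ 2 / 2) with hc₀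
  have hc₀pos : 0 < c₀ := by positivity
  refine ⟨m.toReal * c₀, mul_pos (ENNReal.toReal_pos hm0.ne' (hm.trans_le le_top).ne) hc₀pos, ?_⟩
  filter_upwards [hlim] with n hn x hx
  have h1 : ∫ θ', (Metric.ball (0 : ℝ) A).indicator (fun _ => c₀) θ' ∂(G n : Measure ℝ) ≤
      mixtureDensity (G n) x := by
    refine integral_mono ((integrable_const c₀).indicator measurableSet_ball)
      (integrable_gaussianPDFReal_mean _ x) fun θ' => ?_
    by_cases hθ' : θ' ∈ Metric.ball (0 : ℝ) A
    swap
    · simpa [Set.indicator_of_notMem hθ'] using gaussianPDFReal_nonneg _ _ _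
    simp only [Set.indicator_of_mem hθ']
    rw [gaussianPDFReal_one, hc₀]
    gcongr ?_ * Real.exp (-?_ / 2)
    rw [← sq_abs (x - θ')]
    gcongr
    have h2 : |θ'| < A := by simpa using hθ'
    have h3 : |x - θ'| ≤ |x - θ| + |θ| + |θ'| := by
      rw [show x - θ' = (x - θ) + θ + (-θ') by ring, ← abs_neg θ']
      exact abs_add_three _ _ _
    linarith [le_abs_self L]
  rw [integral_indicator_const _ measurableSet_ball, smul_eq_mul] at h1
  refine le_trans ?_ h1
  gcongr
  exact ENNReal.toReal_mono (measure_ne_top _ _) hn.le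

/-- Convergence to zero in mean under the mixtures `f_{G n}` passes to every Gaussian location. -/
lemma tendsto_lintegral_mul_gaussianPDF {G : ℕ → ProbabilityMeasure ℝ}
    {G₀ : ProbabilityMeasure ℝ} (h : Tendsto G atTop (𝓝 G₀)) {d : ℕ → ℝ → ℝ≥0∞}
    (hd : ∀ n, Measurable (d n)) {C : ℝ≥0∞} (hC : C ≠ ∞)
    (hdC : ∀ n θ, ∫⁻ x, d n x * gaussianPDF θ 1 x ≤ C)
    (hQ : Tendsto (fun n => ∫⁻ x, d n x * ENNReal.ofReal (mixtureDensity (G n) x)) atTop (𝓝 0))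
    (θ : ℝ) : Tendsto (fun n => ∫⁻ x, d n x * gaussianPDF θ 1 x) atTop (𝓝 0) := by
  -- Split at |x - θ| = L: inside, the kernel is at most f/c; outside, it is at most exp(1/2 - L)
  -- times the kernels at θ ± 1, whose integrals `hdC` bounds. Finally L → ∞.
  have key : ∀ L : ℝ, limsup (fun n => ∫⁻ x, d n x * gaussianPDF θ 1 x) atTop ≤
      ENNReal.ofReal (Real.exp (1 / 2 - L)) * (C + C) := by
    intro L
    obtain ⟨c, hc, hlow⟩ := exists_le_mixtureDensity h θ L
    have hlim : Tendsto (fun n => ENNReal.ofReal c⁻¹ *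
        (∫⁻ x, d n x * ENNReal.ofReal (mixtureDensity (G n) x))
          + ENNReal.ofReal (Real.exp (1 / 2 - L)) * (C + C)) atTop
        (𝓝 (ENNReal.ofReal (Real.exp (1 / 2 - L)) * (C + C))) := by
      simpa using (ENNReal.Tendsto.const_mul hQ (.inr ENNReal.ofReal_ne_top)).add_const
        (ENNReal.ofReal (Real.exp (1 / 2 - L)) * (C + C))
    rw [← hlim.limsup_eq]
    refine limsup_le_limsup ?_
    filter_upwards [hlow] with n hn
    have hdn := hd n
    have hmn := measurable_mixtureDensity (G n : Measure ℝ)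
    calc ∫⁻ x, d n x * gaussianPDF θ 1 x
        ≤ ∫⁻ x, (ENNReal.ofReal c⁻¹ * (d n x * ENNReal.ofReal (mixtureDensity (G n) x))
          + ENNReal.ofReal (Real.exp (1 / 2 - L)) *
            (d n x * gaussianPDF (θ + 1) 1 x + d n x * gaussianPDF (θ - 1) 1 x)) := by
          refine lintegral_mono fun x => ?_
          rcases le_or_gt |x - θ| L with hx | hx
          · refine le_trans ?_ le_self_add
            rw [mul_left_comm, ← ENNReal.ofReal_mul (by positivity)]
            gcongr
            refine ENNReal.ofReal_le_ofReal ?_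
            have h1 : gaussianPDFReal θ 1 x ≤ 1 := by
              rw [gaussianPDFReal_one]
              refine mul_le_one₀ inv_sqrt_two_pi_le_one (Real.exp_pos _).le ?_
              rw [Real.exp_le_one_iff]
              nlinarith [sq_nonneg (x - θ)]
            refine h1.trans ?_
            rw [← div_eq_inv_mul, one_le_div hc]
            exact hn x hx
          · refine le_trans ?_ le_add_self
            rw [← mul_add, mul_left_comm]
            gcongr
            have h1 := gaussianPDF_add_le 0 θ x
            rw [add_zero] at h1
            refine h1.trans ?_
            gcongr
            simp only [abs_zero]
            linarith
      _ = ENNReal.ofReal c⁻¹ * (∫⁻ x, d n x * ENNReal.ofReal (mixtureDensity (G n) x))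
          + ENNReal.ofReal (Real.exp (1 / 2 - L)) * ((∫⁻ x, d n x * gaussianPDF (θ + 1) 1 x)
            + ∫⁻ x, d n x * gaussianPDF (θ - 1) 1 x) := by
          rw [lintegral_add_left (by fun_prop), lintegral_const_mul _ (by fun_prop),
            lintegral_const_mul _ (by fun_prop), lintegral_add_left (by fun_prop)]
      _ ≤ _ := by gcongr <;> exact hdC _ _
  have hexp : Tendsto (fun L : ℝ => ENNReal.ofReal (Real.exp (1 / 2 - L)) * (C + C)) atTop
      (𝓝 0) := by
    have h1 : Tendsto (fun L : ℝ => Real.exp (1 / 2 - L)) atTop (𝓝 0) :=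
      Real.tendsto_exp_atBot.comp (tendsto_atBot_add_const_left _ _ tendsto_neg_atTop_atBot)
    simpa using ENNReal.Tendsto.mul_const (b := C + C) (ENNReal.tendsto_ofReal h1)
      (.inr (by finiteness))
  exact tendsto_of_le_liminf_of_limsup_le bot_le (ge_of_tendsto' hexp key)

lemma tendsto_lintegral_sq_sub_mallows {ε : ℝ} (hε0 : 0 < ε) (hε1 : ε < 1)
    {G : ℕ → ProbabilityMeasure ℝ} {G₀ : ProbabilityMeasure ℝ} (h : Tendsto G atTop (𝓝 G₀))
    {δ : ℕ → ℝ → ℝ} {δ₀ : ℝ → ℝ} (hδ : ∀ n, IsMallowsRule ε (G n) (δ n))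
    (hδ₀ : IsMallowsRule ε G₀ δ₀) :
    Tendsto (fun n => ∫⁻ x, ENNReal.ofReal ((δ n x - δ₀ x) ^ 2) *
      ENNReal.ofReal (mixtureDensity (G n) x)) atTop (𝓝 0) := by
  have hmeas₀ := hδ₀.measurable hε0.le hε1.le
  have hrisk := tendsto_quadBayesRisk hmeas₀ (hδ₀.pointwiseRisk_le hε0 hε1.le) h
  have hrfin : ∀ H : ProbabilityMeasure ℝ, quadBayesRisk H δ₀ ≠ ∞ := fun H =>
    ne_top_of_le_ne_top ENNReal.ofReal_ne_top
      (quadBayesRisk_le_of_pointwiseRisk_le (hδ₀.pointwiseRisk_le hε0 hε1.le) H)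
  rw [ENNReal.tendsto_toReal_iff (fun n => hrfin (G n)) (hrfin G₀)] at hrisk
  have hmeas := fun n => (hδ n).measurable hε0.le hε1.le
  choose G' hG' hG'δ using hδ
  choose H hH using fun n => (hG' n).1
  obtain ⟨G₀', hG₀', rfl⟩ := hδ₀
  obtain ⟨H₀, hH₀⟩ := hG₀'.1
  have hPG' := fun n => isProbabilityMeasure_of_mem_contaminationClass hε0.le hε1.le (hG' n).1
  have hPG₀' := isProbabilityMeasure_of_mem_contaminationClass hε0.le hε1.le hG₀'.1
  set a := ENNReal.ofReal (1 - ε) with ha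
  set b := ENNReal.ofReal ε with hb
  have ha0 : a ≠ 0 := by simpa [ha] using hε1
  have ha1 : a ≤ 1 := by rw [ha, ENNReal.ofReal_le_one]; linarith
  have hatop : a ≠ ∞ := ENNReal.ofReal_ne_top
  -- Current initial prior with the limiting contamination: admissible for G n, with kernel moments
  -- converging to those of G₀'.
  let K : ℕ → ProbabilityMeasure ℝ := fun n =>
    ⟨a • (G n : Measure ℝ) + b • (H₀ : Measure ℝ), isProbabilityMeasure_mix hε0.le hε1.le _ _⟩
  set B₀ := quadBayesRisk G₀' (posteriorMean G₀') with hB₀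
  set Q : ℕ → ℝ≥0∞ := fun n => ∫⁻ x, ENNReal.ofReal ((δ n x - posteriorMean G₀' x) ^ 2) *
      ENNReal.ofReal (mixtureDensity (G n) x) with hQ
  have hBfin : B₀ ≠ ∞ := ne_top_of_le_ne_top ENNReal.one_ne_top (quadBayesRisk_posteriorMean_le_one G₀')
  have hBK : B₀ ≤ liminf (fun n => quadBayesRisk (K n) (posteriorMean (K n))) atTop := by
    have := quadBayesRisk_posteriorMean_le_liminf (G := K) (G₀ := ⟨G₀', hPG₀'⟩) fun k hk x => by
      simp only [K, ProbabilityMeasure.coe_mk, hH₀, a, b, kernelMoment_mix hk hε0.le hε1.le]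
      exact ((tendsto_kernelMoment hk h x).const_mul _).add_const _
    simpa using this
  have hmain : ∀ n, quadBayesRisk (K n) (posteriorMean (K n)) + a * Q n
      + a * quadBayesRisk G₀ (posteriorMean G₀') ≤
        a * quadBayesRisk (G n) (posteriorMean G₀') + B₀ := by
    intro n
    -- The opposite pairing, G₀ with H n; it absorbs the uncontrolled term b · r(H n, δ₀) coming
    -- from G' n.
    have hsad := hG₀'.quadBayesRisk_le hε0.le hε1.le
      (K := a • (G₀ : Measure ℝ) + b • (H n : Measure ℝ)) ⟨H n, rfl⟩
    rw [quadBayesRisk_mix] at hsad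
    have h1 : quadBayesRisk (K n) (posteriorMean (K n)) ≤
        quadBayesRisk (G' n) (posteriorMean (G' n)) :=
      quadBayesRisk_posteriorMean_anti ((hG' n).2 _ ⟨H₀, rfl⟩)
    -- Dropping the contamination leaves f_{G' n} ≥ (1-ε) f_{G n}.
    have h2 : a * Q n ≤ ∫⁻ x, ENNReal.ofReal ((posteriorMean G₀' x - posteriorMean (G' n) x) ^ 2
        * mixtureDensity (G' n) x) := by
      have hn := hmeas n
      have hmn := measurable_mixtureDensity (G n : Measure ℝ)
      rw [hQ, ← lintegral_const_mul _ (by fun_prop)]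
      refine lintegral_mono fun x => ?_
      rw [ha, ← hG'δ, mul_left_comm, ← ENNReal.ofReal_mul (by linarith),
        ← ENNReal.ofReal_mul (sq_nonneg _)]
      refine ENNReal.ofReal_le_ofReal ?_
      rw [← neg_sub (δ n x), neg_sq]
      refine mul_le_mul_of_nonneg_left ?_ (sq_nonneg _)
      rw [← kernelMoment_zero (G' n), hH n, kernelMoment_mix (by norm_num) hε0.le hε1.le,
        kernelMoment_zero, kernelMoment_zero]
      have := mixtureDensity_nonneg (H n) x
      nlinarith
    have h3 := quadBayesRisk_eq_add (G' n) hmeas₀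
    have h4 : quadBayesRisk (G' n) (posteriorMean G₀') =
        a * quadBayesRisk (G n) (posteriorMean G₀') + b * quadBayesRisk (H n) (posteriorMean G₀') := by
      rw [hH n, quadBayesRisk_mix]
    calc _ ≤ quadBayesRisk (G' n) (posteriorMean (G' n))
          + (∫⁻ x, ENNReal.ofReal ((posteriorMean G₀' x - posteriorMean (G' n) x) ^ 2
            * mixtureDensity (G' n) x)) + a * quadBayesRisk G₀ (posteriorMean G₀') := by gcongr
      _ = a * quadBayesRisk (G n) (posteriorMean G₀') +
          (a * quadBayesRisk G₀ (posteriorMean G₀') + b * quadBayesRisk (H n) (posteriorMean G₀')) := by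
          rw [← h3, h4]; ring
      _ ≤ _ := by gcongr
  have haQ : Tendsto (fun n => a * Q n) atTop (𝓝 0) := by
    rw [ENNReal.tendsto_nhds_zero]
    intro η hη
    have hη2 : η / 2 ≠ 0 := by simpa using hη.ne'
    have e1 : ∀ᶠ n in atTop, B₀ ≤ quadBayesRisk (K n) (posteriorMean (K n)) + η / 2 := by
      rcases eq_or_ne B₀ 0 with h0 | h0
      · simp [h0]
      · filter_upwards [eventually_lt_of_lt_liminf
          ((ENNReal.sub_lt_self hBfin h0 hη2).trans_le hBK)] with n hn
        exact tsub_le_iff_right.1 hn.le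
    have e2 : ∀ᶠ n in atTop, quadBayesRisk (G n) (posteriorMean G₀') ≤
        quadBayesRisk G₀ (posteriorMean G₀') + η / 2 :=
      (hrisk.eventually_lt_const (ENNReal.lt_add_right (hrfin G₀) hη2)).mono fun _ hn => hn.le
    filter_upwards [e1, e2] with n h1 h2
    have hKfin : quadBayesRisk (K n) (posteriorMean (K n)) ≠ ∞ :=
      ne_top_of_le_ne_top ENNReal.one_ne_top (quadBayesRisk_posteriorMean_le_one _)
    have hfin : quadBayesRisk (K n) (posteriorMean (K n))
        + a * quadBayesRisk G₀ (posteriorMean G₀') ≠ ∞ :=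
      ENNReal.add_ne_top.2 ⟨hKfin, ENNReal.mul_ne_top hatop (hrfin G₀)⟩
    refine (ENNReal.add_le_add_iff_left hfin).1 ?_
    calc _ = quadBayesRisk (K n) (posteriorMean (K n)) + a * Q n
          + a * quadBayesRisk G₀ (posteriorMean G₀') := by ring
      _ ≤ a * quadBayesRisk (G n) (posteriorMean G₀') + B₀ := hmain n
      _ ≤ a * (quadBayesRisk G₀ (posteriorMean G₀') + η / 2)
          + (quadBayesRisk (K n) (posteriorMean (K n)) + η / 2) := by gcongr
      _ ≤ (a * quadBayesRisk G₀ (posteriorMean G₀') + 1 * (η / 2))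
          + (quadBayesRisk (K n) (posteriorMean (K n)) + η / 2) := by rw [mul_add]; gcongr
      _ = quadBayesRisk (K n) (posteriorMean (K n))
          + a * quadBayesRisk G₀ (posteriorMean G₀') + (η / 2 + η / 2) := by ring
      _ = _ := by rw [ENNReal.add_halves]
  have := ENNReal.Tendsto.const_mul (a := a⁻¹) haQ (.inr (ENNReal.inv_ne_top.2 ha0))
  simpa only [← mul_assoc, ENNReal.inv_mul_cancel ha0 hatop, one_mul, mul_zero] using this

/-- Young's inequality with weight s; used in both directions it replaces the triangle inequality in
L². -/
lemma pointwiseRisk_le_add {δ δ' : ℝ → ℝ} (hδ : Measurable δ) (hδ' : Measurable δ') {s : ℝ}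
    (hs : 0 < s) (θ : ℝ) :
    pointwiseRisk δ θ ≤ ENNReal.ofReal (1 + s) * pointwiseRisk δ' θ + ENNReal.ofReal (1 + s⁻¹) *
      ∫⁻ x, ENNReal.ofReal ((δ x - δ' x) ^ 2) * gaussianPDF θ 1 x := by
  rw [pointwiseRisk_eq hδ, pointwiseRisk_eq hδ', ← lintegral_const_mul _ (by fun_prop),
    ← lintegral_const_mul _ (by fun_prop), ← lintegral_add_left (by fun_prop)]
  refine lintegral_mono fun x => ?_
  rw [← mul_assoc, ← mul_assoc, ← add_mul, ← ENNReal.ofReal_mul (by positivity),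
    ← ENNReal.ofReal_mul (by positivity), ← ENNReal.ofReal_add (by positivity) (by positivity)]
  gcongr
  have h1 : (1 + s) * (δ' x - θ) ^ 2 + (1 + s⁻¹) * (δ x - δ' x) ^ 2 - (δ x - θ) ^ 2
      = s⁻¹ * (s * (δ' x - θ) - (δ x - δ' x)) ^ 2 := by
    field_simp
    ring
  have h2 : 0 ≤ s⁻¹ * (s * (δ' x - θ) - (δ x - δ' x)) ^ 2 := by positivity
  linarith

lemma lintegral_sq_sub_mul_gaussianPDF_le {δ δ' : ℝ → ℝ} (hδ : Measurable δ)
    (hδ' : Measurable δ') (θ : ℝ) :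
    ∫⁻ x, ENNReal.ofReal ((δ x - δ' x) ^ 2) * gaussianPDF θ 1 x ≤
      2 * pointwiseRisk δ θ + 2 * pointwiseRisk δ' θ := by
  rw [pointwiseRisk_eq hδ, pointwiseRisk_eq hδ', ← lintegral_const_mul _ (by fun_prop),
    ← lintegral_const_mul _ (by fun_prop), ← lintegral_add_left (by fun_prop)]
  refine lintegral_mono fun x => ?_
  rw [← mul_assoc, ← mul_assoc, ← add_mul, ← ENNReal.ofReal_ofNat, ← ENNReal.ofReal_mul (by positivity),
    ← ENNReal.ofReal_mul (by positivity), ← ENNReal.ofReal_add (by positivity) (by positivity)]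
  gcongr
  nlinarith [sq_nonneg (δ x - θ + (δ' x - θ))]

lemma tendsto_of_forall_le_add {x T : ℕ → ℝ} {x₀ C : ℝ} (hx : ∀ n, x n ≤ C) (hx₀ : x₀ ≤ C)
    (hC : 0 < C) (hT : Tendsto T atTop (𝓝 0))
    (h₁ : ∀ s > 0, ∀ n, x n ≤ (1 + s) * x₀ + (1 + s⁻¹) * T n)
    (h₂ : ∀ s > 0, ∀ n, x₀ ≤ (1 + s) * x n + (1 + s⁻¹) * T n) :
    Tendsto x atTop (𝓝 x₀) := by
  rw [Metric.tendsto_nhds]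
  intro η hη
  have hs : 0 < η / (2 * C) := by positivity
  have hT' : Tendsto (fun n => (1 + (η / (2 * C))⁻¹) * T n) atTop (𝓝 0) := by
    simpa using hT.const_mul (1 + (η / (2 * C))⁻¹)
  filter_upwards [hT'.eventually_lt_const (half_pos hη)] with n hn
  have hsC : η / (2 * C) * C = η / 2 := by field_simp
  have h3 := mul_le_mul_of_nonneg_left (hx n) hs.le
  have h4 := mul_le_mul_of_nonneg_left hx₀ hs.le
  have h5 := h₁ _ hs n
  have h6 := h₂ _ hs n
  rw [Real.dist_eq, abs_lt]
  constructor <;> linarith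

lemma tendsto_pointwiseRisk_mallows {ε : ℝ} (hε0 : 0 < ε) (hε1 : ε < 1)
    {G : ℕ → ProbabilityMeasure ℝ} {G₀ : ProbabilityMeasure ℝ} (h : Tendsto G atTop (𝓝 G₀))
    {δ : ℕ → ℝ → ℝ} {δ₀ : ℝ → ℝ} (hδ : ∀ n, IsMallowsRule ε (G n) (δ n))
    (hδ₀ : IsMallowsRule ε G₀ δ₀) (θ : ℝ) :
    Tendsto (fun n => pointwiseRisk (δ n) θ) atTop (𝓝 (pointwiseRisk δ₀ θ)) := by
  have hm := fun n => (hδ n).measurable hε0.le hε1.le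
  have hm₀ := hδ₀.measurable hε0.le hε1.le
  have hR := fun n => (hδ n).pointwiseRisk_le hε0 hε1.le
  have hR₀ := hδ₀.pointwiseRisk_le hε0 hε1.le
  have hfin : ∀ n, pointwiseRisk (δ n) θ ≠ ∞ := fun n =>
    ne_top_of_le_ne_top ENNReal.ofReal_ne_top (hR n θ)
  have hfin₀ : pointwiseRisk δ₀ θ ≠ ∞ := ne_top_of_le_ne_top ENNReal.ofReal_ne_top (hR₀ θ)
  have hTle : ∀ n θ, ∫⁻ x, ENNReal.ofReal ((δ n x - δ₀ x) ^ 2) * gaussianPDF θ 1 x ≤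
      2 * ENNReal.ofReal (1 / ε) + 2 * ENNReal.ofReal (1 / ε) := fun n θ =>
    (lintegral_sq_sub_mul_gaussianPDF_le (hm n) hm₀ θ).trans (by gcongr; exacts [hR n θ, hR₀ θ])
  have hCfin : 2 * ENNReal.ofReal (1 / ε) + 2 * ENNReal.ofReal (1 / ε) ≠ ∞ := by finiteness
  have hT := tendsto_lintegral_mul_gaussianPDF h
    (d := fun n x => ENNReal.ofReal ((δ n x - δ₀ x) ^ 2))
    (fun n => by have := hm n; fun_prop) hCfin hTle
    (tendsto_lintegral_sq_sub_mallows hε0 hε1 h hδ hδ₀) θ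
  have hTfin := fun n => ne_top_of_le_ne_top hCfin (hTle n θ)
  have hTreal := (ENNReal.tendsto_toReal ENNReal.zero_ne_top).comp hT
  have hconv : ∀ {s : ℝ} {u v w : ℝ≥0∞}, 0 < s → v ≠ ∞ → w ≠ ∞ →
      u ≤ ENNReal.ofReal (1 + s) * v + ENNReal.ofReal (1 + s⁻¹) * w →
      u.toReal ≤ (1 + s) * v.toReal + (1 + s⁻¹) * w.toReal := by
    intro s u v w hs hv hw hle
    have := ENNReal.toReal_mono (by finiteness) hle
    rwa [ENNReal.toReal_add (by finiteness) (by finiteness), ENNReal.toReal_mul,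
      ENNReal.toReal_mul, ENNReal.toReal_ofReal (by positivity),
      ENNReal.toReal_ofReal (by positivity)] at this
  rw [← ENNReal.tendsto_toReal_iff hfin hfin₀]
  have hb : ∀ {u : ℝ≥0∞}, u ≤ ENNReal.ofReal (1 / ε) → u.toReal ≤ 1 / ε := fun hu =>
    ENNReal.toReal_le_of_le_ofReal (by positivity) hu
  refine tendsto_of_forall_le_add (C := 1 / ε) (fun n => hb (hR n θ)) (hb (hR₀ θ))
    (by positivity) (by simpa [Function.comp_def] using hTreal)
    (fun s hs n => hconv hs hfin₀ (hTfin n) (pointwiseRisk_le_add (hm n) hm₀ hs θ))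
    (fun s hs n => hconv hs (hfin n) (hTfin n) ?_)
  have hle := pointwiseRisk_le_add hm₀ (hm n) hs θ
  have hsymm : ∀ x, (δ₀ x - δ n x) ^ 2 = (δ n x - δ₀ x) ^ 2 := fun x => by ring
  simpa only [hsymm] using hle

/-! ### Excess Bayes risk: deterministic and stochastic convergence -/

lemma tendsto_excessRisk_mallows {ε : ℝ} (hε0 : 0 < ε) (hε1 : ε < 1)
    {G : ℕ → ProbabilityMeasure ℝ} {G₀ : ProbabilityMeasure ℝ}
    (h : Tendsto (fun n => hellingerDist (mixtureDensity (G n)) (mixtureDensity G₀)) atTop (𝓝 0))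
    {δ : ℕ → ℝ → ℝ} {δ₀ : ℝ → ℝ} (hδ : ∀ n, IsMallowsRule ε (G n) (δ n))
    (hδ₀ : IsMallowsRule ε G₀ δ₀) :
    Tendsto (fun n => excessRisk G₀ (δ n) δ₀) atTop (𝓝 0) := by
  have hr : Tendsto (fun n => quadBayesRisk G₀ (δ n)) atTop (𝓝 (quadBayesRisk G₀ δ₀)) :=
    tendsto_lintegral_of_dominated_convergence (fun _ => ENNReal.ofReal (1 / ε))
      (fun n => measurable_pointwiseRisk ((hδ n).measurable hε0.le hε1.le))
      (fun n => .of_forall ((hδ n).pointwiseRisk_le hε0 hε1.le)) (by simp)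
      (.of_forall (tendsto_pointwiseRisk_mallows hε0 hε1
        (tendsto_of_tendsto_hellingerDist h) hδ hδ₀))
  have hfin : quadBayesRisk G₀ δ₀ ≠ ∞ := ne_top_of_le_ne_top ENNReal.ofReal_ne_top
    (quadBayesRisk_le_of_pointwiseRisk_le (hδ₀.pointwiseRisk_le hε0 hε1.le) G₀)
  simpa [excessRisk] using
    ((ENNReal.tendsto_toReal hfin).comp hr).sub_const (quadBayesRisk G₀ δ₀).toReal

/-- A modulus uniform over all priors and their Mallows rules: counterexamples at κ = 1/(n+1) would
form a sequence contradicting the deterministic limit. It transfers convergence in probability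
without measurability in ω. -/
lemma exists_abs_excessRisk_lt {ε : ℝ} (hε0 : 0 < ε) (hε1 : ε < 1)
    {G₀ : ProbabilityMeasure ℝ} {δ₀ : ℝ → ℝ} (hδ₀ : IsMallowsRule ε G₀ δ₀) {η : ℝ} (hη : 0 < η) :
    ∃ κ > 0, ∀ (G : ProbabilityMeasure ℝ) (δ : ℝ → ℝ), IsMallowsRule ε G δ →
      hellingerDist (mixtureDensity G) (mixtureDensity G₀) < κ → |excessRisk G₀ δ δ₀| < η := by
  by_contra! hcon
  choose G δ hδ hG hbad using fun n : ℕ => hcon (1 / ((n : ℝ) + 1)) (by positivity)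
  have hlim : Tendsto (fun n => hellingerDist (mixtureDensity (G n)) (mixtureDensity G₀)) atTop
      (𝓝 0) :=
    squeeze_zero (fun _ => Real.sqrt_nonneg _) (fun n => (hG n).le)
      tendsto_one_div_add_atTop_nhds_zero_nat
  have := (tendsto_excessRisk_mallows hε0 hε1 hlim hδ hδ₀).abs
  rw [abs_zero] at this
  exact hη.not_ge (ge_of_tendsto' this hbad)

lemma abs_excessRisk_le {ε : ℝ} (hε0 : 0 < ε) (hε1 : ε ≤ 1) {G G₀ : ProbabilityMeasure ℝ}
    {δ δ₀ : ℝ → ℝ} (hδ : IsMallowsRule ε G δ) (hδ₀ : IsMallowsRule ε G₀ δ₀) :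
    |excessRisk G₀ δ δ₀| ≤ 1 / ε := by
  have hb : ∀ {H : ProbabilityMeasure ℝ} {δ' : ℝ → ℝ}, IsMallowsRule ε H δ' →
      (quadBayesRisk G₀ δ').toReal ≤ 1 / ε := fun h =>
    ENNReal.toReal_le_of_le_ofReal (by positivity)
      (quadBayesRisk_le_of_pointwiseRisk_le (h.pointwiseRisk_le hε0 hε1) G₀)
  have h1 := hb hδ
  have h2 := hb hδ₀
  have h3 : 0 ≤ (quadBayesRisk G₀ δ).toReal := ENNReal.toReal_nonneg
  have h4 : 0 ≤ (quadBayesRisk G₀ δ₀).toReal := ENNReal.toReal_nonneg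
  rw [excessRisk, abs_le]
  constructor <;> linarith

/-- Bounded convergence in outer measure implies convergence in mean. -/
lemma tendsto_lintegral_of_tendsto_measure_of_le {Ω : Type*} [MeasurableSpace Ω] {P : Measure Ω}
    [IsProbabilityMeasure P] {f : ℕ → Ω → ℝ} {C : ℝ} (hC : ∀ n ω, |f n ω| ≤ C)
    (h : ∀ η > 0, Tendsto (fun n => P {ω | η ≤ |f n ω|}) atTop (𝓝 0)) :
    Tendsto (fun n => ∫⁻ ω, ENNReal.ofReal |f n ω| ∂P) atTop (𝓝 0) := by
  have key : ∀ η : ℝ, 0 < η →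
      limsup (fun n => ∫⁻ ω, ENNReal.ofReal |f n ω| ∂P) atTop ≤ ENNReal.ofReal η := by
    intro η hη
    have hlim : Tendsto (fun n => ENNReal.ofReal η + ENNReal.ofReal C * P {ω | η ≤ |f n ω|}) atTop
        (𝓝 (ENNReal.ofReal η)) := by
      simpa using (ENNReal.Tendsto.const_mul (h η hη)
        (.inr ENNReal.ofReal_ne_top)).const_add (ENNReal.ofReal η)
    rw [← hlim.limsup_eq]
    refine limsup_le_limsup (.of_forall fun n => ?_)
    -- The functions f n need not be measurable, so a measurable hull of equal measure replaces the
    -- exceptional set.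
    set S := toMeasurable P {ω | η ≤ |f n ω|}
    calc ∫⁻ ω, ENNReal.ofReal |f n ω| ∂P
        ≤ ∫⁻ ω, (ENNReal.ofReal η + S.indicator (fun _ => ENNReal.ofReal C) ω) ∂P := by
          refine lintegral_mono fun ω => ?_
          rcases lt_or_ge |f n ω| η with hlt | hge
          · exact le_add_right (ENNReal.ofReal_le_ofReal hlt.le)
          · have hmem : ω ∈ S := subset_toMeasurable _ _ hge
            rw [Set.indicator_of_mem hmem]
            exact le_add_left (ENNReal.ofReal_le_ofReal (hC n ω))
      _ = _ := by
          rw [lintegral_add_left measurable_const,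
            lintegral_indicator_const (measurableSet_toMeasurable _ _),
            measure_toMeasurable]
          simp
  refine tendsto_of_le_liminf_of_limsup_le bot_le ?_
  refine le_of_forall_gt_imp_ge_of_dense fun c hc => ?_
  obtain ⟨η, -, hη0, hηc⟩ := ENNReal.lt_iff_exists_real_btwn.1 hc
  exact (key η (ENNReal.ofReal_pos.1 hη0)).trans hηc.le

theorem mainTheorem1 {Ω : Type*} [MeasurableSpace Ω] (P : Measure Ω) [IsProbabilityMeasure P]
    (ε : ℝ) (hε0 : 0 < ε) (hε1 : ε < 1)
    (G₀ : ProbabilityMeasure ℝ)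
    (X : ℕ → Ω → ℝ) (hX : ∀ i, HasLaw (X i) (mixtureLaw G₀) P)
    (Ghat : ℕ → Ω → ProbabilityMeasure ℝ)
    (hGhat : ∀ n ω, IsNPMLE n (fun i => X i ω) (Ghat n ω))
    (δM : ℝ → ℝ) (hδM : IsMallowsRule ε G₀ δM)
    (δhat : ℕ → Ω → ℝ → ℝ) (hδhat : ∀ n ω, IsMallowsRule ε (Ghat n ω) (δhat n ω)) :
    -- all the risks are finite
    quadBayesRisk G₀ δM ≠ ∞ ∧ (∀ n ω, quadBayesRisk G₀ (δhat n ω) ≠ ∞) ∧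
    -- almost sure Hellinger consistency
    ((∀ᵐ ω ∂P, Tendsto
        (fun n => hellingerDist (mixtureDensity (Ghat n ω)) (mixtureDensity G₀)) atTop (𝓝 0)) →
      ∀ᵐ ω ∂P, Tendsto (fun n => excessRisk G₀ (δhat n ω) δM) atTop (𝓝 0)) ∧
    -- Hellinger consistency in probability
    (TendstoInMeasure P
        (fun n ω => hellingerDist (mixtureDensity (Ghat n ω)) (mixtureDensity G₀)) atTop
        (fun _ => 0) →
      TendstoInMeasure P (fun n ω => excessRisk G₀ (δhat n ω) δM) atTop (fun _ => 0) ∧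
      Tendsto (fun n => ∫⁻ ω, ENNReal.ofReal |excessRisk G₀ (δhat n ω) δM| ∂P) atTop (𝓝 0)) := by
  have hfin : ∀ {H : ProbabilityMeasure ℝ} {δ : ℝ → ℝ}, IsMallowsRule ε H δ →
      quadBayesRisk G₀ δ ≠ ∞ := fun h => ne_top_of_le_ne_top ENNReal.ofReal_ne_top
    (quadBayesRisk_le_of_pointwiseRisk_le (h.pointwiseRisk_le hε0 hε1.le) G₀)
  refine ⟨hfin hδM, fun n ω => hfin (hδhat n ω), fun h => ?_, fun h => ?_⟩
  · filter_upwards [h] with ω hω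
    exact tendsto_excessRisk_mallows hε0 hε1 hω (hδhat · ω) hδM
  · rw [tendstoInMeasure_iff_norm] at h
    have hmeas : ∀ η > 0, Tendsto (fun n => P {ω | η ≤ |excessRisk G₀ (δhat n ω) δM|}) atTop
        (𝓝 0) := by
      intro η hη
      obtain ⟨κ, hκ, hbound⟩ := exists_abs_excessRisk_lt hε0 hε1 hδM hη
      refine tendsto_of_tendsto_of_tendsto_of_le_of_le tendsto_const_nhds (h κ hκ)
        (fun _ => zero_le) fun n => measure_mono fun ω hω => ?_
      by_contra hlt
      simp only [sub_zero, Set.mem_ofPred_eq, not_le] at hlt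
      exact (hbound _ _ (hδhat n ω) ((le_abs_self _).trans_lt hlt)).not_ge hω
    refine ⟨?_, tendsto_lintegral_of_tendsto_measure_of_le
      (fun n ω => abs_excessRisk_le hε0 hε1.le (hδhat n ω) hδM) hmeas⟩
    rw [tendstoInMeasure_iff_norm]
    simpa using hmeas
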